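/- **Definitions.** A Ferrers diagram is a top and left justified arrangement of square cells with possibly empty rows and columns; its length is the number of its rows plus the number of its columns. For a Ferrers diagram $F$ with $k$ columns, the shifted diagram $\overline F$ is obtained by adding $k$ rows of sizes $1,2,\dots,k$ (in this order, from top to bottom) above $F$; the rightmost cell of an added row is called a diagonal cell, and the length of $\overline F$ is that of $F$. A type $B$ permutation tableau of length $n$ is a $0,1$-filling of a shifted Ferrers diagram of length $n$ such that (1) each column contains at least one $1$; (2) no $0$ has both a $1$ above it in the same column and a $1$ to the left of it in the same row; (3) a $0$ in a diagonal cell has no $1$ to the left of it in the same row. Let $\mathcal{PT}_B(n)$ be the set of these tableaux. For $T\in\mathcal{PT}_B(n)$, let $\mathrm{row}(T)$ be the number of rows of $T$ other than the added ones, $\mathrm{diag}(T)$ the number of ones in diagonal cells, and $\mathrm{so}(T)$ the number of ones that have a $1$ above them in the same column. Put $$B_n(y,t,q)=\sum_{T\in\mathcal{PT}_B(n)}y^{2\,\mathrm{row}(T)+\mathrm{diag}(T)}\,t^{\mathrm{diag}(T)}\,q^{\mathrm{so}(T)},\qquad [n]_q=\frac{1-q^n}{1-q}=1+q+\dots+q^{n-1}.$$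 **Theorem.** Let $$\gamma_h=y^2[h+1]_q+[h]_q+tyq^h\big([h]_q+[h+1]_q\big)\ (h\ge 0),\qquad \lambda_h=y[h]_q^2\,(y+tq^{h-1})(1+ytq^h)\ (h\ge1).$$ Then, as formal power series in $z$ (the infinite continued fraction being the coefficientwise limit of its finite truncations), $$\sum_{n\ge0}B_n(y,t,q)\,z^n=\cfrac{1}{1-\gamma_0z-\cfrac{\lambda_1z^2}{1-\gamma_1z-\cfrac{\lambda_2z^2}{1-\gamma_2z-\cdots}}}.$$ -/

import Mathlib

open Finset

/-- A Ferrers diagram: a top and left justified arrangement of cells, in which some of the last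
rows and some of the last columns may be empty. Cells are pairs (row, column), counted from `0`
at the top left; the numbers of rows and columns (empty ones included) are part of the data. -/
structure FerrersDiagram where
  rows : ℕ
  cols : ℕ
  cells : Finset (ℕ × ℕ)
  cells_subset : cells ⊆ range rows ×ˢ range cols
  isLowerSet : IsLowerSet (cells : Set (ℕ × ℕ))

namespace FerrersDiagram

/-- The length: the number of rows plus the number of columns. -/
def length (F : FerrersDiagram) : ℕ := F.rows + F.cols

/-- The cells of the shifted Ferrers diagram: `F.cols` rows of sizes `1, 2, …, F.cols` are added
above `F`. The added rows are the rows `0, …, F.cols - 1`, the diagonal cells are the cells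
`(i, i)` with `i < F.cols`, and row `i` of `F` becomes row `F.cols + i`. -/
def shiftedCells (F : FerrersDiagram) : Finset (ℕ × ℕ) :=
  {c ∈ range F.cols ×ˢ range F.cols | c.2 ≤ c.1} ∪
    F.cells.image (fun c => (F.cols + c.1, c.2))

end FerrersDiagram

/-- Type B permutation tableaux of length `n`. The `0,1`-filling of the shifted diagram is given
by the set `ones` of the cells that contain a `1`. -/
structure TypeBPermutationTableau (n : ℕ) where
  shape : FerrersDiagram
  length_eq : shape.length = n
  ones : Finset (ℕ × ℕ)
  ones_subset : ones ⊆ shape.shiftedCells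
  /-- Each column has at least one `1`. -/
  exists_one : ∀ j < shape.cols, ∃ i, (i, j) ∈ ones
  /-- No `0` has a `1` above it in the same column and a `1` to its left in the same row. -/
  zero_condition : ∀ i j, (i, j) ∈ shape.shiftedCells → (i, j) ∉ ones →
    ¬ ((∃ i' < i, (i', j) ∈ ones) ∧ (∃ j' < j, (i, j') ∈ ones))
  /-- A `0` in a diagonal cell does not have a `1` to its left in the same row. -/
  diagonal_condition : ∀ i < shape.cols, (i, i) ∉ ones → ∀ j < i, (i, j) ∉ ones

namespace TypeBPermutationTableau

variable {n : ℕ}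

/-- The number of rows, the added ones excepted. -/
def row (T : TypeBPermutationTableau n) : ℕ := T.shape.rows

/-- The number of ones in diagonal cells. -/
def diag (T : TypeBPermutationTableau n) : ℕ :=
  #{i ∈ range T.shape.cols | (i, i) ∈ T.ones}

/-- The number of superfluous ones: those that have a `1` above them in the same column. -/
def so (T : TypeBPermutationTableau n) : ℕ :=
  #{c ∈ T.ones | ∃ i < c.1, (i, c.2) ∈ T.ones}

instance : Finite (TypeBPermutationTableau n) := by
  let f : TypeBPermutationTableau n →
      Fin (n + 1) × Fin (n + 1) × {s // s ∈ (range n ×ˢ range n).powerset} ×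
        {s // s ∈ (range (n + n) ×ˢ range n).powerset} := fun T =>
    have hr : T.shape.rows ≤ n := by
      have := T.length_eq; unfold FerrersDiagram.length at this; omega
    have hc : T.shape.cols ≤ n := by
      have := T.length_eq; unfold FerrersDiagram.length at this; omega
    (⟨T.shape.rows, by omega⟩, ⟨T.shape.cols, by omega⟩,
      ⟨T.shape.cells, by
        rw [mem_powerset]
        intro c hcc
        have := T.shape.cells_subset hcc
        simp only [mem_product, mem_range] at this ⊢
        omega⟩,
      ⟨T.ones, by
        rw [mem_powerset]
        intro c hcc
        have := T.ones_subset hcc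
        simp only [FerrersDiagram.shiftedCells, mem_union, mem_filter, mem_product, mem_range,
          mem_image] at this ⊢
        rcases this with h | ⟨d, hd, rfl⟩
        · omega
        · have := T.shape.cells_subset hd
          simp only [mem_product, mem_range] at this
          dsimp only
          omega⟩)
  refine Finite.of_injective f ?_
  rintro ⟨⟨r, c, s, h1, h2⟩, h3, o, h4, h5, h6, h7⟩ ⟨⟨r', c', s', h1', h2'⟩, h3', o', h4', h5', h6', h7'⟩ h
  simp only [f, Prod.mk.injEq, Fin.mk.injEq, Subtype.mk.injEq] at h
  obtain ⟨rfl, rfl, rfl, rfl⟩ := h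
  rfl

noncomputable instance : Fintype (TypeBPermutationTableau n) := Fintype.ofFinite _

end TypeBPermutationTableau

section

variable {R : Type*} [CommRing R]

/-- The polynomial `B_n(y,t,q)`, evaluated at elements `y`, `t`, `q` of a commutative ring. -/
noncomputable def tableauPolynomial (y t q : R) (n : ℕ) : R :=
  ∑ T : TypeBPermutationTableau n, y ^ (2 * T.row + T.diag) * t ^ T.diag * q ^ T.so

/-- `[n]_q = (1 - q ^ n) / (1 - q)`, as the polynomial `1 + q + ⋯ + q ^ (n - 1)`. -/
def qInt (q : R) (n : ℕ) : R := ∑ i ∈ range n, q ^ i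

/-- The finite J-fraction with `N` levels that starts at level `h`:
`1 / (1 - γ_h z - λ_{h+1} z² / (1 - γ_{h+1} z - ⋯ - λ_{h+N-1} z² / (1 - γ_{h+N-1} z)))`.
The inverse is that of a power series with constant coefficient `1`. -/
noncomputable def jFractionTrunc (γ lam : ℕ → R) : ℕ → ℕ → PowerSeries R
  | 0, _ => 0
  | N + 1, h => PowerSeries.invOfUnit
      (1 - PowerSeries.C (γ h) * PowerSeries.X
        - PowerSeries.C (lam (h + 1)) * PowerSeries.X ^ 2 * jFractionTrunc γ lam N (h + 1)) 1

/-- The denominators really are inverted. -/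
theorem mul_jFractionTrunc_succ (γ lam : ℕ → R) (N h : ℕ) :
    (1 - PowerSeries.C (γ h) * PowerSeries.X
        - PowerSeries.C (lam (h + 1)) * PowerSeries.X ^ 2 * jFractionTrunc γ lam N (h + 1))
      * jFractionTrunc γ lam (N + 1) h = 1 := by
  rw [jFractionTrunc]
  exact PowerSeries.mul_invOfUnit _ _ (by simp)

/-- `F` is the value of the infinite J-fraction
`1 / (1 - γ_0 z - λ_1 z² / (1 - γ_1 z - λ_2 z² / (1 - ⋯)))`: the finite truncations converge to `F`
as formal power series, that is, each of their coefficients is eventually that of `F`. -/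
def IsJFractionExpansion (F : PowerSeries R) (γ lam : ℕ → R) : Prop :=
  ∀ n : ℕ, ∀ᶠ N in Filter.atTop,
    PowerSeries.coeff n (jFractionTrunc γ lam N 0) = PowerSeries.coeff n F

end

/-! A tableau of length `n + 1` arises in exactly one way from one of length `n`: by an empty row at
the bottom, or by a full-height column on the left together with its one-cell added row at the top
(`extend_bijective`). In the new column a `1` may stand only in the new diagonal cell and in
unrestricted rows, and which rows are unrestricted afterwards depends only on the filling of that
column.

Let x mark the unrestricted rows. Summing over the fillings (`mul_sum_columnChoices`) shows that the
generating polynomials P_n(x) are the iterates on 1 of f ↦ y²x f(x) + ytx f(1+qx) + x (f(1+qx) -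
f(x))/(1+qx-x). This operator is tridiagonal in the Newton basis with nodes [1]_q, [2]_q, …
(`isStep_qNewton_succ`), so the coordinates of P_n count weighted Motzkin paths. At x = 1 = [1]_q
only the constant basis element survives, hence B_n = P_n(1) counts the paths from height 0 to
height 0, whose generating function is the J-fraction. -/

/-! ### Weighted Motzkin paths and J-fractions. -/

section JFraction

variable {R : Type*} [CommRing R]

/-- The weighted number of Motzkin paths with `n` steps from height `0` to height `k`; the steps
from height `h` have weight `b h` (up), `γ h` (level), `c h` (down). -/
def motzkinWeight (b γ c : ℕ → R) : ℕ → ℕ → R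
  | 0, 0 => 1
  | 0, _ + 1 => 0
  | n + 1, 0 => γ 0 * motzkinWeight b γ c n 0 + c 1 * motzkinWeight b γ c n 1
  | n + 1, k + 1 => b k * motzkinWeight b γ c n k + γ (k + 1) * motzkinWeight b γ c n (k + 1)
      + c (k + 2) * motzkinWeight b γ c n (k + 2)

variable (b γ c : ℕ → R)

theorem motzkinWeight_eq_zero {n k : ℕ} (h : n < k) : motzkinWeight b γ c n k = 0 := by
  induction n generalizing k with
  | zero => obtain _ | k := k <;> simp [motzkinWeight] at *
  | succ n ih =>
    obtain _ | k := k
    · omega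
    · rw [motzkinWeight, ih (by omega), ih (by omega), ih (by omega)]
      simp

/-- The generating function of the Motzkin paths that end at height `k`. -/
noncomputable def motzkinSeries (k : ℕ) : PowerSeries R :=
  PowerSeries.mk fun n => motzkinWeight b γ c n k

theorem motzkinSeries_zero : motzkinSeries b γ c 0 = 1 + PowerSeries.X *
    (PowerSeries.C (γ 0) * motzkinSeries b γ c 0 + PowerSeries.C (c 1) * motzkinSeries b γ c 1) := by
  ext n
  obtain _ | n := n
  · simp [motzkinSeries, motzkinWeight]
  · simp [motzkinSeries, motzkinWeight, PowerSeries.coeff_succ_X_mul, PowerSeries.coeff_one]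

theorem motzkinSeries_succ (k : ℕ) : motzkinSeries b γ c (k + 1) = PowerSeries.X *
    (PowerSeries.C (b k) * motzkinSeries b γ c k
      + PowerSeries.C (γ (k + 1)) * motzkinSeries b γ c (k + 1)
      + PowerSeries.C (c (k + 2)) * motzkinSeries b γ c (k + 2)) := by
  ext n
  obtain _ | n := n
  · simp [motzkinSeries, motzkinWeight]
  · simp [motzkinSeries, motzkinWeight, PowerSeries.coeff_succ_X_mul]

/-- Approximate form of the cut at the last up step from height `k` to `k + 1`. Substituting the
congruence for height `k + 2` into the last-step equation reproduces the denominator of the next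
truncation, and the factor `X` of that equation gains one order of precision. -/
theorem X_pow_dvd_motzkinSeries_sub {lam : ℕ → R} (hlam : ∀ k, lam (k + 1) = b k * c (k + 1))
    (N k : ℕ) : PowerSeries.X ^ N ∣ motzkinSeries b γ c (k + 1) -
      PowerSeries.X * PowerSeries.C (b k) * motzkinSeries b γ c k
        * jFractionTrunc γ lam N (k + 1) := by
  induction N generalizing k with
  | zero => simp
  | succ N ih =>
    obtain ⟨r, hr⟩ := ih (k + 1)
    have h1 := motzkinSeries_succ b γ c k
    have h2 := mul_jFractionTrunc_succ γ lam N (k + 1)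
    refine ⟨PowerSeries.C (c (k + 2)) * r * jFractionTrunc γ lam (N + 1) (k + 1), ?_⟩
    rw [hlam, map_mul] at h2
    linear_combination (jFractionTrunc γ lam (N + 1) (k + 1)) * h1
      - motzkinSeries b γ c (k + 1) * h2 + PowerSeries.X * PowerSeries.C (c (k + 2)) *
        jFractionTrunc γ lam (N + 1) (k + 1) * hr

/-- The generating function of Motzkin paths is a J-fraction. -/
theorem isJFractionExpansion_motzkinWeight {lam : ℕ → R}
    (hlam : ∀ k, lam (k + 1) = b k * c (k + 1)) :
    IsJFractionExpansion (PowerSeries.mk fun n => motzkinWeight b γ c n 0) γ lam := by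
  intro n
  filter_upwards [Filter.eventually_gt_atTop (n + 1)] with N hN
  obtain ⟨N, rfl⟩ : ∃ M, N = M + 1 := ⟨N - 1, by omega⟩
  have h : PowerSeries.X ^ (N + 1) ∣ motzkinSeries b γ c 0 - jFractionTrunc γ lam (N + 1) 0 := by
    obtain ⟨r, hr⟩ := X_pow_dvd_motzkinSeries_sub b γ c hlam N 0
    have h1 := motzkinSeries_zero b γ c
    have h2 := mul_jFractionTrunc_succ γ lam N 0
    refine ⟨PowerSeries.C (c 1) * r * jFractionTrunc γ lam (N + 1) 0, ?_⟩
    rw [hlam, map_mul] at h2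
    linear_combination (jFractionTrunc γ lam (N + 1) 0) * h1
      - motzkinSeries b γ c 0 * h2 + PowerSeries.X * PowerSeries.C (c 1) *
        jFractionTrunc γ lam (N + 1) 0 * hr
  have := PowerSeries.X_pow_dvd_iff.1 h n (by omega)
  rw [map_sub, sub_eq_zero] at this
  exact this.symm

end JFraction

/-! ### The step operator in the q-Newton basis. -/

section Newton

open Polynomial

variable {R : Type*} [CommRing R]

theorem qInt_succ (q : R) (n : ℕ) : qInt q (n + 1) = 1 + q * qInt q n := by
  simp [qInt, sum_range_succ', mul_sum, pow_succ', add_comm]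

theorem one_add_mul_qInt (q : R) (n : ℕ) : 1 + (q - 1) * qInt q n = q ^ n := by
  have := mul_geom_sum q n
  unfold qInt
  linear_combination this

/-- The Newton basis with nodes `[1]_q, [2]_q, …`. -/
noncomputable def qNewton (q : R) (k : ℕ) : R[X] := ∏ i ∈ range k, (X - C (qInt q (i + 1)))

theorem qNewton_succ (q : R) (k : ℕ) :
    qNewton q (k + 1) = qNewton q k * (X - C (qInt q (k + 1))) := prod_range_succ _ _

theorem eval_one_qNewton_succ (q : R) (k : ℕ) : (qNewton q (k + 1)).eval 1 = 0 := by
  rw [qNewton, prod_range_succ', eval_mul]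
  simp [qInt]

/-- Since [i+1]_q = 1 + q[i]_q, the substitution turns each factor X - [i+1]_q into q(X - [i]_q):
the nodes move down by one, and the first becomes [0]_q = 0. -/
theorem qNewton_succ_comp (q : R) (k : ℕ) :
    (qNewton q (k + 1)).comp (1 + C q * X) = C (q ^ (k + 1)) * X * qNewton q k := by
  induction k with
  | zero => simp [qNewton, qInt]
  | succ k ih =>
    rw [qNewton_succ, mul_comp, ih, qNewton_succ q k, sub_comp, X_comp, C_comp,
      qInt_succ q (k + 1)]
    simp only [map_add, map_mul, map_pow, map_one]
    ring

/-- `g` is the image of `f` under the operator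
`f ↦ y²xf(x) + ytxf(1+qx) + x(f(1+qx) - f(x))/(1+qx-x)`. -/
def IsStep (y t q : R) (f g : R[X]) : Prop :=
  (1 + C q * X - X) * g = (1 + C q * X - X) * (C (y ^ 2) * X * f
    + C (y * t) * X * f.comp (1 + C q * X)) + X * (f.comp (1 + C q * X) - f)

theorem IsStep.smul {y t q : R} {f g : R[X]} (a : R) (h : IsStep y t q f g) :
    IsStep y t q (C a * f) (C a * g) := by
  unfold IsStep at *
  rw [mul_comp, C_comp]
  linear_combination C a * h

theorem IsStep.sum {y t q : R} {ι : Type*} {s : Finset ι} {f g : ι → R[X]}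
    (h : ∀ i ∈ s, IsStep y t q (f i) (g i)) :
    IsStep y t q (∑ i ∈ s, f i) (∑ i ∈ s, g i) := by
  unfold IsStep at *
  have hc : (∑ i ∈ s, f i).comp (1 + C q * X) = ∑ i ∈ s, (f i).comp (1 + C q * X) :=
    map_sum (compRingHom _) f s
  rw [mul_sum, sum_congr rfl h, hc]
  simp only [mul_sum, sum_add_distrib, sum_sub_distrib, mul_add, mul_sub]

/-- The factor 1 + qX - X can be cancelled over any commutative ring: its constant term is 1, so it
is a unit among power series. -/
theorem IsStep.unique {y t q : R} {f g g' : R[X]} (h : IsStep y t q f g)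
    (h' : IsStep y t q f g') : g = g' := by
  have h0 : (1 + C q * X - X) * g = (1 + C q * X - X) * g' := h.trans h'.symm
  have hu : IsUnit ((1 + C q * X - X : R[X]) : PowerSeries R) := by
    rw [PowerSeries.isUnit_iff_constantCoeff]
    simp
  apply Polynomial.coe_injective R
  apply hu.mul_left_cancel
  rw [← Polynomial.coe_mul, h0, Polynomial.coe_mul]

theorem isStep_qNewton_zero (y t q : R) : IsStep y t q (qNewton q 0)
    (C (y * (y + t * q ^ 0)) * qNewton q 1 + C (y ^ 2 + t * y) * qNewton q 0) := by
  simp only [IsStep, qNewton, qInt, range_zero, prod_empty, one_comp, prod_range_one, zero_add,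
    sum_range_one, pow_zero, map_add, map_mul, map_pow, map_one]
  ring

/-- Write N_k for the basis. The difference N_{k+1}(1+qX) - N_{k+1} equals N_k (q^{k+1}X - X +
[k+1]_q) = [k+1]_q (1+qX-X) N_k, so the quotient is [k+1]_q N_k. The rest is repeated use of X N_k =
N_{k+1} + [k+1]_q N_k. -/
theorem isStep_qNewton_succ (y t q : R) (k : ℕ) : IsStep y t q (qNewton q (k + 1))
    (C (y * (y + t * q ^ (k + 1))) * qNewton q (k + 2)
      + C (y ^ 2 * qInt q (k + 2) + qInt q (k + 1)
        + t * y * q ^ (k + 1) * (qInt q (k + 1) + qInt q (k + 2))) * qNewton q (k + 1)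
      + C (qInt q (k + 1) ^ 2 * (1 + y * t * q ^ (k + 1))) * qNewton q k) := by
  have h : (C q ^ (k + 1) : R[X]) = 1 + (C q - 1) * C (qInt q (k + 1)) := by
    have := congrArg (C : R → R[X]) (one_add_mul_qInt q (k + 1))
    simpa using this.symm
  rw [IsStep, qNewton_succ_comp, qNewton_succ q (k + 1), qNewton_succ q k]
  simp only [map_add, map_mul, map_pow, map_one]
  linear_combination (-X * X * qNewton q k) * h

/-- The polynomials obtained from `1` by iterating the step operator, in the Newton basis. -/
theorem eq_sum_motzkinWeight_qNewton {y t q : R} {P : ℕ → R[X]} (h0 : P 0 = 1)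
    (hP : ∀ n, IsStep y t q (P n) (P (n + 1))) (n : ℕ) :
    P n = ∑ k ∈ range (n + 1), C (motzkinWeight (fun h => y * (y + t * q ^ h))
      (fun h => y ^ 2 * qInt q (h + 1) + qInt q h + t * y * q ^ h * (qInt q h + qInt q (h + 1)))
      (fun h => qInt q h ^ 2 * (1 + y * t * q ^ h)) n k) * qNewton q k := by
  induction n with
  | zero => simp [motzkinWeight, qNewton, h0]
  | succ n ih =>
    set b : ℕ → R := fun h => y * (y + t * q ^ h) with hb
    set γ : ℕ → R := fun h => y ^ 2 * qInt q (h + 1) + qInt q h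
      + t * y * q ^ h * (qInt q h + qInt q (h + 1)) with hγ
    set c : ℕ → R := fun h => qInt q h ^ 2 * (1 + y * t * q ^ h) with hc
    set A := motzkinWeight b γ c with hA
    -- At `k = 0` the truncated `k - 1` is harmless, because `c 0 = 0`.
    have hstep : ∀ k, IsStep y t q (qNewton q k)
        (C (b k) * qNewton q (k + 1) + C (γ k) * qNewton q k
          + C (c k) * qNewton q (k - 1)) := by
      rintro (_ | k)
      · convert isStep_qNewton_zero y t q using 1
        simp [hb, hγ, hc, qInt]
      · exact isStep_qNewton_succ y t q k
    have h1 := hP n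
    rw [ih] at h1
    rw [h1.unique (IsStep.sum fun k _ => (hstep k).smul (A n k))]
    have hz : ∀ k, n < k → A n k = 0 := fun k hk => motzkinWeight_eq_zero b γ c hk
    have hc0 : c 0 = 0 := by simp [hc, qInt]
    -- The term `k = 0` drops out by `c 0 = 0`; the terms added on the right vanish because no path
    -- of `n` steps rises above `n`.
    have e1 : ∑ k ∈ range (n + 1), C (A n k * c k) * qNewton q (k - 1)
        = ∑ k ∈ range (n + 2), C (A n (k + 1) * c (k + 1)) * qNewton q k := by
      rw [sum_range_succ', sum_range_succ (n := n + 1), sum_range_succ (n := n)]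
      simp [hc0, hz]
    have e2 : ∑ k ∈ range (n + 1), C (A n k * γ k) * qNewton q k
        = ∑ k ∈ range (n + 2), C (A n k * γ k) * qNewton q k := by
      rw [sum_range_succ (n := n + 1)]
      simp [hz]
    calc _ = ∑ k ∈ range (n + 1), C (A n k * b k) * qNewton q (k + 1)
          + ∑ k ∈ range (n + 1), C (A n k * γ k) * qNewton q k
          + ∑ k ∈ range (n + 1), C (A n k * c k) * qNewton q (k - 1) := by
            simp only [← sum_add_distrib, map_mul]
            exact sum_congr rfl fun k _ => by ring
      _ = _ := by
            rw [e1, e2, sum_range_succ' _ (n + 1), sum_range_succ' _ (n + 1),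
              sum_range_succ' _ (n + 1)]
            have : ∀ k, A (n + 1) (k + 1) = b k * A n k + γ (k + 1) * A n (k + 1)
              + c (k + 2) * A n (k + 2) := fun k => rfl
            have h' : A (n + 1) 0 = γ 0 * A n 0 + c 1 * A n 1 := rfl
            simp only [this, h', map_add, map_mul, add_mul, sum_add_distrib, zero_add]
            simp only [mul_comm (C (A n _)), mul_assoc]
            ring

/-- The first node is [1]_q = 1, so evaluation at 1 extracts the coordinate of index 0. -/
theorem eval_one_eq_motzkinWeight {y t q : R} {P : ℕ → R[X]} (h0 : P 0 = 1)
    (hP : ∀ n, IsStep y t q (P n) (P (n + 1))) (n : ℕ) :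
    (P n).eval 1 = motzkinWeight (fun h => y * (y + t * q ^ h))
      (fun h => y ^ 2 * qInt q (h + 1) + qInt q h + t * y * q ^ h * (qInt q h + qInt q (h + 1)))
      (fun h => qInt q h ^ 2 * (1 + y * t * q ^ h)) n 0 := by
  rw [eq_sum_motzkinWeight_qNewton h0 hP, eval_finsetSum, sum_range_succ', sum_eq_zero]
  · simp [qNewton]
  · intro k _
    rw [eval_mul, eval_one_qNewton_succ, mul_zero]

end Newton

/-! ### Growth of Ferrers diagrams by an empty row or a full column. -/

namespace FerrersDiagram

theorem ext {F G : FerrersDiagram} (hr : F.rows = G.rows) (hc : F.cols = G.cols)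
    (h : ∀ i j, (i, j) ∈ F.cells ↔ (i, j) ∈ G.cells) : F = G := by
  obtain ⟨r, c, s, h1, h2⟩ := F
  obtain ⟨r', c', s', h1', h2'⟩ := G
  obtain rfl : s = s' := Finset.ext fun ⟨i, j⟩ => h i j
  subst hr hc
  rfl

theorem lt_of_mem_cells {F : FerrersDiagram} {i j : ℕ} (h : (i, j) ∈ F.cells) :
    i < F.rows ∧ j < F.cols := by
  simpa using F.cells_subset h

theorem mem_cells_of_le {F : FerrersDiagram} {i j i' j' : ℕ} (h : (i, j) ∈ F.cells) (hi : i' ≤ i)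
    (hj : j' ≤ j) : (i', j') ∈ F.cells :=
  F.isLowerSet (show ((i', j') : ℕ × ℕ) ≤ (i, j) from ⟨hi, hj⟩) h

theorem mem_shiftedCells {F : FerrersDiagram} {i j : ℕ} : (i, j) ∈ F.shiftedCells ↔
    (j ≤ i ∧ i < F.cols) ∨ (F.cols ≤ i ∧ (i - F.cols, j) ∈ F.cells) := by
  simp only [shiftedCells, mem_union, mem_filter, mem_product, mem_range, mem_image,
    Prod.mk.injEq, Prod.exists]
  constructor
  · rintro (h | ⟨a, b, h, rfl, rfl⟩)
    · left; omega
    · right; simpa using h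
  · rintro (h | ⟨h, h'⟩)
    · left; omega
    · right; exact ⟨_, _, h', by omega, rfl⟩

theorem lt_of_mem_shiftedCells {F : FerrersDiagram} {i j : ℕ} (h : (i, j) ∈ F.shiftedCells) :
    i < F.rows + F.cols ∧ j < F.cols := by
  rcases mem_shiftedCells.1 h with h | ⟨h, h'⟩
  · omega
  · have := lt_of_mem_cells h'
    omega

/-- Add an empty row at the bottom. -/
def addRow (F : FerrersDiagram) : FerrersDiagram where
  rows := F.rows + 1
  cols := F.cols
  cells := F.cells
  cells_subset := F.cells_subset.trans (product_subset_product_left (by simp))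
  isLowerSet := F.isLowerSet

/-- Add a column of full height on the left. -/
def addCol (F : FerrersDiagram) : FerrersDiagram where
  rows := F.rows
  cols := F.cols + 1
  cells := {c ∈ range F.rows ×ˢ range (F.cols + 1) | c.2 = 0 ∨ (c.1, c.2 - 1) ∈ F.cells}
  cells_subset := filter_subset _ _
  isLowerSet := by
    rintro ⟨i, j⟩ ⟨i', j'⟩ ⟨hi, hj⟩ h
    simp only [coe_filter, mem_product, mem_range, Set.mem_ofPred_eq] at h hi hj ⊢
    refine ⟨by omega, ?_⟩
    rcases h.2 with h | h
    · left; omega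
    · exact Or.inr (mem_cells_of_le h hi (by omega))

theorem mem_addCol_zero {F : FerrersDiagram} {i : ℕ} : (i, 0) ∈ F.addCol.cells ↔ i < F.rows := by
  simp [addCol]

theorem mem_addCol_succ {F : FerrersDiagram} {i j : ℕ} :
    (i, j + 1) ∈ F.addCol.cells ↔ (i, j) ∈ F.cells := by
  simp only [addCol, mem_filter, mem_product, mem_range]
  constructor
  · simp
  · intro h
    have := lt_of_mem_cells h
    simp [h, this]

theorem mem_shiftedCells_addCol_zero {F : FerrersDiagram} {i : ℕ} :
    (i, 0) ∈ F.addCol.shiftedCells ↔ i < F.rows + F.cols + 1 := by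
  rw [mem_shiftedCells, mem_addCol_zero]
  simp only [addCol]
  omega

/-- The new column also brings a new top row of size 1, so the old shifted diagram moves one step
along the diagonal. -/
theorem mem_shiftedCells_addCol_succ {F : FerrersDiagram} {i j : ℕ} :
    (i + 1, j + 1) ∈ F.addCol.shiftedCells ↔ (i, j) ∈ F.shiftedCells := by
  rw [mem_shiftedCells, mem_shiftedCells, mem_addCol_succ]
  simp [addCol]

theorem notMem_shiftedCells_zero_succ {F : FerrersDiagram} {j : ℕ} :
    (0, j + 1) ∉ F.shiftedCells := by
  rw [mem_shiftedCells]
  rintro (h | ⟨h, h'⟩)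
  · omega
  · have := lt_of_mem_cells h'
    omega

theorem exists_addRow_eq {F : FerrersDiagram} {r : ℕ} (hr : F.rows = r + 1)
    (h : (r, 0) ∉ F.cells) : ∃ G : FerrersDiagram, G.addRow = F := by
  refine ⟨⟨r, F.cols, F.cells, ?_, F.isLowerSet⟩, ext hr.symm rfl fun i j => Iff.rfl⟩
  rintro ⟨i, j⟩ hij
  have h1 := lt_of_mem_cells hij
  have h2 : i < r := by
    by_contra h3
    exact h (mem_cells_of_le hij (by omega) (by omega))
  simp [h1, h2]

/-- If the last row, when there is one, is nonempty, then the first column has full height and can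
be removed. -/
theorem exists_addCol_eq {F : FerrersDiagram} (hc : 0 < F.cols)
    (h : ∀ r, F.rows = r + 1 → (r, 0) ∈ F.cells) : ∃ G : FerrersDiagram, G.addCol = F := by
  refine ⟨⟨F.rows, F.cols - 1, {c ∈ range F.rows ×ˢ range (F.cols - 1) | (c.1, c.2 + 1) ∈ F.cells},
    filter_subset _ _, ?_⟩, ext rfl (Nat.sub_add_cancel hc) ?_⟩
  · rintro ⟨i, j⟩ ⟨i', j'⟩ ⟨hi, hj⟩ h
    simp only [coe_filter, mem_product, mem_range, Set.mem_ofPred_eq] at h hi hj ⊢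
    exact ⟨by omega, mem_cells_of_le h.2 hi (by omega)⟩
  · rintro i (_ | j)
    · rw [mem_addCol_zero]
      constructor
      · intro hi
        simp only at hi
        exact mem_cells_of_le (h (F.rows - 1) (by omega)) (by omega) le_rfl
      · intro hi
        exact (lt_of_mem_cells hi).1
    · rw [mem_addCol_succ]
      simp only [mem_filter, mem_product, mem_range, and_iff_right_iff_imp]
      intro hi
      have := lt_of_mem_cells hi
      omega

end FerrersDiagram

/-! ### Growth of tableaux and the effect on the statistics. -/

namespace TypeBPermutationTableau

open FerrersDiagram

variable {n : ℕ}

theorem ext {T T' : TypeBPermutationTableau n} (hs : T.shape = T'.shape)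
    (h : ∀ i j, (i, j) ∈ T.ones ↔ (i, j) ∈ T'.ones) : T = T' := by
  obtain ⟨s, h1, o, h2, h3, h4, h5⟩ := T
  obtain ⟨s', h1', o', h2', h3', h4', h5'⟩ := T'
  obtain rfl : o = o' := Finset.ext fun ⟨i, j⟩ => h i j
  subst hs
  rfl

theorem rows_add_cols (T : TypeBPermutationTableau n) : T.shape.rows + T.shape.cols = n :=
  T.length_eq

theorem lt_cols_of_mem_ones {T : TypeBPermutationTableau n} {i j : ℕ} (h : (i, j) ∈ T.ones) :
    j < T.shape.cols :=
  (lt_of_mem_shiftedCells (T.ones_subset h)).2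

/-- A row is unrestricted if no `0` in it has a `1` above, and if it has no `0` in a diagonal
cell. These are the rows in which a `1` can be put to the left of all cells. -/
def IsUnrestricted (T : TypeBPermutationTableau n) (i : ℕ) : Prop :=
  (∀ j, (i, j) ∈ T.shape.shiftedCells → (i, j) ∉ T.ones → ∀ i' < i, (i', j) ∉ T.ones) ∧
    (i < T.shape.cols → (i, i) ∈ T.ones)

open Classical in
/-- The set of the unrestricted rows. -/
noncomputable def unrestricted (T : TypeBPermutationTableau n) : Finset ℕ :=
  {i ∈ range n | T.IsUnrestricted i}

theorem mem_unrestricted {T : TypeBPermutationTableau n} {i : ℕ} :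
    i ∈ T.unrestricted ↔ i < n ∧ T.IsUnrestricted i := by
  simp [unrestricted]

/-- Each column has exactly one `1` that is not superfluous. -/
theorem so_add_cols (T : TypeBPermutationTableau n) : T.so + T.shape.cols = #T.ones := by
  rw [so, ← card_filter_add_card_filter_not (s := T.ones) (fun c => ∃ i < c.1, (i, c.2) ∈ T.ones)]
  congr 1
  symm
  rw [← card_range T.shape.cols]
  refine card_nbij Prod.snd ?_ ?_ ?_
  · rintro ⟨i, j⟩ h
    simp only [coe_filter, Set.mem_ofPred_eq] at h
    simpa using lt_cols_of_mem_ones h.1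
  · rintro ⟨i, j⟩ h ⟨i', j'⟩ h' (rfl : j = j')
    simp only [coe_filter, Set.mem_ofPred_eq, not_exists, not_and] at h h'
    rcases lt_trichotomy i i' with h1 | rfl | h1
    · exact absurd h.1 (h'.2 i h1)
    · rfl
    · exact absurd h'.1 (h.2 i' h1)
  · intro j hj
    have hex := T.exists_one j (by simpa using hj)
    classical
    refine ⟨(Nat.find hex, j), ?_, rfl⟩
    simp only [coe_filter, Set.mem_ofPred_eq, not_exists, not_and]
    exact ⟨Nat.find_spec hex, fun i hi => Nat.find_min hex hi⟩

/-- Add an empty row at the bottom. -/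
def addRow (T : TypeBPermutationTableau n) : TypeBPermutationTableau (n + 1) where
  shape := T.shape.addRow
  length_eq := by
    have := T.rows_add_cols
    simp only [FerrersDiagram.length, FerrersDiagram.addRow]
    omega
  ones := T.ones
  ones_subset := T.ones_subset
  exists_one := T.exists_one
  zero_condition := T.zero_condition
  diagonal_condition := T.diagonal_condition

theorem row_addRow (T : TypeBPermutationTableau n) : T.addRow.row = T.row + 1 := rfl

theorem diag_addRow (T : TypeBPermutationTableau n) : T.addRow.diag = T.diag := rfl

theorem so_addRow (T : TypeBPermutationTableau n) : T.addRow.so = T.so := rfl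

theorem unrestricted_addRow (T : TypeBPermutationTableau n) :
    T.addRow.unrestricted = insert n T.unrestricted := by
  ext i
  have h : ∀ i, T.addRow.IsUnrestricted i ↔ T.IsUnrestricted i := fun i => Iff.rfl
  -- Row `n` lies below the shifted diagram of `T`, so both conditions are vacuous.
  have hn : T.IsUnrestricted n := by
    have := T.rows_add_cols
    refine ⟨fun j hj => ?_, fun h => ?_⟩
    · have := (lt_of_mem_shiftedCells hj).1
      omega
    · omega
  rw [mem_insert, mem_unrestricted, mem_unrestricted, h]
  constructor
  · rintro ⟨h1, h2⟩
    by_cases hi : i = n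
    · exact Or.inl hi
    · exact Or.inr ⟨by omega, h2⟩
  · rintro (rfl | ⟨h1, h2⟩)
    · exact ⟨by omega, hn⟩
    · exact ⟨by omega, h2⟩

theorem card_unrestricted_addRow (T : TypeBPermutationTableau n) :
    #T.addRow.unrestricted = #T.unrestricted + 1 := by
  rw [unrestricted_addRow, card_insert_of_notMem]
  simp [mem_unrestricted]

/-- The ones of a filling with a new first column and a new first row above it. The new row has
only the diagonal cell; `b` tells whether this cell contains a `1`, and the other ones in the new
column are in the rows of `S`. -/
def addColOnes (T : TypeBPermutationTableau n) (b : Bool) (S : Finset ℕ) : Finset (ℕ × ℕ) :=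
  ((if b then {(0, 0)} else ∅) ∪ S.image fun i => (i + 1, 0)) ∪
    T.ones.image fun c => (c.1 + 1, c.2 + 1)

section addColOnes

variable {T : TypeBPermutationTableau n} {b : Bool} {S : Finset ℕ} {i j : ℕ}

theorem zero_zero_mem_addColOnes : (0, 0) ∈ T.addColOnes b S ↔ b = true := by
  cases b <;> simp [addColOnes]

theorem succ_zero_mem_addColOnes : (i + 1, 0) ∈ T.addColOnes b S ↔ i ∈ S := by
  cases b <;> simp [addColOnes]

theorem zero_succ_notMem_addColOnes : (0, j + 1) ∉ T.addColOnes b S := by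
  cases b <;> simp [addColOnes]

theorem succ_succ_mem_addColOnes : (i + 1, j + 1) ∈ T.addColOnes b S ↔ (i, j) ∈ T.ones := by
  cases b <;> simp [addColOnes]

theorem card_addColOnes : #(T.addColOnes b S) = b.toNat + #S + #T.ones := by
  rw [addColOnes, card_union_of_disjoint, card_union_of_disjoint, card_image_of_injective,
    card_image_of_injective]
  · cases b <;> simp
  · rintro ⟨i, j⟩ ⟨i', j'⟩ h
    simpa using h
  · intro i j h
    simpa using h
  · cases b <;> simp
  · rw [disjoint_left]
    cases b <;> simp +contextual

end addColOnes

/-- Add a first column of full height (and the row of its diagonal cell). -/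
def addCol (T : TypeBPermutationTableau n) (b : Bool) (S : Finset ℕ) (hS : S ⊆ T.unrestricted)
    (hb : b = true ∨ S.Nonempty) : TypeBPermutationTableau (n + 1) where
  shape := T.shape.addCol
  length_eq := by
    have := T.rows_add_cols
    simp only [FerrersDiagram.length, FerrersDiagram.addCol]
    omega
  ones := T.addColOnes b S
  ones_subset := by
    have hn := T.rows_add_cols
    rintro ⟨_ | i, _ | j⟩ h
    · rw [mem_shiftedCells_addCol_zero]
      omega
    · exact absurd h zero_succ_notMem_addColOnes
    · rw [succ_zero_mem_addColOnes] at h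
      have := (mem_unrestricted.1 (hS h)).1
      rw [mem_shiftedCells_addCol_zero]
      omega
    · rw [succ_succ_mem_addColOnes] at h
      exact mem_shiftedCells_addCol_succ.2 (T.ones_subset h)
  exists_one := by
    rintro (_ | j) hj
    · rcases hb with hb | ⟨i, hi⟩
      · exact ⟨0, zero_zero_mem_addColOnes.2 hb⟩
      · exact ⟨i + 1, succ_zero_mem_addColOnes.2 hi⟩
    · obtain ⟨i, hi⟩ := T.exists_one j (Nat.lt_of_succ_lt_succ hj)
      exact ⟨i + 1, succ_succ_mem_addColOnes.2 hi⟩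
  zero_condition := by
    rintro (_ | i) (_ | j) hc h ⟨⟨i', hi', h1⟩, j', hj', h2⟩
    · omega
    · omega
    · omega
    · rw [succ_succ_mem_addColOnes] at h
      rw [mem_shiftedCells_addCol_succ] at hc
      obtain _ | i' := i'
      · exact zero_succ_notMem_addColOnes h1
      rw [succ_succ_mem_addColOnes] at h1
      obtain _ | j' := j'
      · rw [succ_zero_mem_addColOnes] at h2
        exact (mem_unrestricted.1 (hS h2)).2.1 j hc h i' (by omega) h1
      · rw [succ_succ_mem_addColOnes] at h2
        exact T.zero_condition i j hc h ⟨⟨i', by omega, h1⟩, j', by omega, h2⟩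
  diagonal_condition := by
    rintro (_ | i) hi h j hj h'
    · omega
    · rw [succ_succ_mem_addColOnes] at h
      replace hi : i < T.shape.cols := Nat.lt_of_succ_lt_succ hi
      obtain _ | j := j
      · rw [succ_zero_mem_addColOnes] at h'
        exact h ((mem_unrestricted.1 (hS h')).2.2 hi)
      · rw [succ_succ_mem_addColOnes] at h'
        exact T.diagonal_condition i hi h j (by omega) h'

section addCol

variable (T : TypeBPermutationTableau n) (b : Bool) (S : Finset ℕ) (hS : S ⊆ T.unrestricted)
    (hb : b = true ∨ S.Nonempty)

theorem row_addCol : (T.addCol b S hS hb).row = T.row := rfl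

theorem diag_addCol : (T.addCol b S hS hb).diag = T.diag + b.toNat := by
  change #{i ∈ range (T.shape.cols + 1) | (i, i) ∈ T.addColOnes b S} = _
  rw [card_filter, sum_range_succ']
  simp only [succ_succ_mem_addColOnes, zero_zero_mem_addColOnes, diag, card_filter]
  cases b <;> rfl

/-- By `so_add_cols` it suffices to count all ones; the `+ 1` is the topmost `1` of the new column.
-/
theorem so_addCol : (T.addCol b S hS hb).so + 1 = T.so + b.toNat + #S := by
  have h1 := (T.addCol b S hS hb).so_add_cols
  have h2 := T.so_add_cols
  have h3 : #(T.addCol b S hS hb).ones = b.toNat + #S + #T.ones := card_addColOnes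
  have h4 : (T.addCol b S hS hb).shape.cols = T.shape.cols + 1 := rfl
  omega

theorem isUnrestricted_addCol_zero : (T.addCol b S hS hb).IsUnrestricted 0 ↔ b = true := by
  refine ⟨fun h => zero_zero_mem_addColOnes.1 (h.2 (Nat.succ_pos _)), fun h => ⟨?_, ?_⟩⟩
  · intro j _ _ i hi
    omega
  · intro _
    exact zero_zero_mem_addColOnes.2 h

/-- An unrestricted row is lost exactly when its new cell is a `0` below some `1` of the new column,
either the diagonal one or one in `S`. -/
theorem isUnrestricted_addCol_succ {i : ℕ} (hi : i < n) :
    (T.addCol b S hS hb).IsUnrestricted (i + 1) ↔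
      T.IsUnrestricted i ∧ (i ∈ S ∨ (b = false ∧ ∀ s ∈ S, i ≤ s)) := by
  have hn := T.rows_add_cols
  constructor
  · rintro ⟨h1, h2⟩
    refine ⟨⟨?_, ?_⟩, ?_⟩
    · intro j hj hj' i' hi' h'
      exact h1 (j + 1) (mem_shiftedCells_addCol_succ.2 hj)
        (fun h => hj' (succ_succ_mem_addColOnes.1 h)) (i' + 1) (by omega)
        (succ_succ_mem_addColOnes.2 h')
    · intro h
      exact succ_succ_mem_addColOnes.1 (h2 (Nat.succ_lt_succ h))
    · by_cases hiS : i ∈ S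
      · exact Or.inl hiS
      have h3 := h1 0 (mem_shiftedCells_addCol_zero.2 (by omega))
        (fun h => hiS (succ_zero_mem_addColOnes.1 h))
      refine Or.inr ⟨?_, ?_⟩
      · by_contra h
        exact h3 0 (by omega) (zero_zero_mem_addColOnes.2 (by simpa using h))
      · intro s hs
        by_contra h
        exact h3 (s + 1) (by omega) (succ_zero_mem_addColOnes.2 hs)
  · rintro ⟨⟨h1, h2⟩, h3⟩
    refine ⟨?_, ?_⟩
    · rintro (_ | j) hj hj' (_ | i') hi' h'
      · replace hj' := fun h => hj' (succ_zero_mem_addColOnes.2 h)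
        replace h' := zero_zero_mem_addColOnes.1 h'
        simp_all
      · replace hj' := fun h => hj' (succ_zero_mem_addColOnes.2 h)
        replace h' := succ_zero_mem_addColOnes.1 h'
        rcases h3 with h3 | ⟨_, h3⟩
        · exact hj' h3
        · have := h3 i' h'
          omega
      · exact zero_succ_notMem_addColOnes h'
      · exact h1 j (mem_shiftedCells_addCol_succ.1 hj)
          (fun h => hj' (succ_succ_mem_addColOnes.2 h)) i' (by omega)
          (succ_succ_mem_addColOnes.1 h')
    · intro h
      exact succ_succ_mem_addColOnes.2 (h2 (Nat.lt_of_succ_lt_succ h))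

theorem card_unrestricted_addCol : #(T.addCol b S hS hb).unrestricted =
    #{i ∈ T.unrestricted | i ∈ S ∨ (b = false ∧ ∀ s ∈ S, i ≤ s)} + b.toNat := by
  classical
  rw [unrestricted, unrestricted, filter_filter, card_filter, card_filter, sum_range_succ']
  congr 1
  · refine sum_congr rfl fun i hi => if_congr ?_ rfl rfl
    exact isUnrestricted_addCol_succ T b S hS hb (mem_range.1 hi)
  · rw [if_congr (isUnrestricted_addCol_zero T b S hS hb) rfl rfl]
    cases b <;> rfl

end addCol

theorem exists_addRow_eq {T : TypeBPermutationTableau (n + 1)} {r : ℕ} (hr : T.shape.rows = r + 1)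
    (h : (r, 0) ∉ T.shape.cells) : ∃ T' : TypeBPermutationTableau n, T'.addRow = T := by
  obtain ⟨F, hF⟩ := FerrersDiagram.exists_addRow_eq hr h
  obtain ⟨s, h1, o, h2, h3, h4, h5⟩ := T
  dsimp only at hF
  subst hF
  refine ⟨⟨F, ?_, o, h2, h3, h4, h5⟩, rfl⟩
  simp only [FerrersDiagram.length, FerrersDiagram.addRow] at h1 ⊢
  omega

theorem exists_addCol_eq {T : TypeBPermutationTableau (n + 1)}
    (h : ∀ r, T.shape.rows = r + 1 → (r, 0) ∈ T.shape.cells) :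
    ∃ (T' : TypeBPermutationTableau n) (b : Bool) (S : Finset ℕ) (hS : S ⊆ T'.unrestricted)
      (hb : b = true ∨ S.Nonempty), T'.addCol b S hS hb = T := by
  have hn := T.rows_add_cols
  -- Without columns there would be `n + 1` rows, all empty, against `h`.
  have hc : 0 < T.shape.cols := by
    by_contra hc
    have := lt_of_mem_cells (h n (by omega))
    omega
  obtain ⟨F, hF⟩ := FerrersDiagram.exists_addCol_eq hc h
  obtain ⟨s, h1, o, h2, h3, h4, h5⟩ := T
  dsimp only at hF
  subst hF
  clear h hc hn
  have hn : F.rows + F.cols = n := by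
    simp only [FerrersDiagram.length, FerrersDiagram.addCol] at h1
    omega
  let o' : Finset (ℕ × ℕ) := {c ∈ range n ×ˢ range n | (c.1 + 1, c.2 + 1) ∈ o}
  have ho : ∀ i j, (i, j) ∈ o' ↔ (i + 1, j + 1) ∈ o := by
    intro i j
    simp only [o', mem_filter, mem_product, mem_range, and_iff_right_iff_imp]
    intro hij
    have := lt_of_mem_shiftedCells (mem_shiftedCells_addCol_succ.1 (h2 hij))
    omega
  have h0 : ∀ j, (0, j + 1) ∉ o := fun j hj => notMem_shiftedCells_zero_succ (h2 hj)
  let T' : TypeBPermutationTableau n :=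
    { shape := F
      length_eq := hn
      ones := o'
      ones_subset := by
        rintro ⟨i, j⟩ hij
        exact mem_shiftedCells_addCol_succ.1 (h2 ((ho i j).1 hij))
      exists_one := by
        intro j hj
        obtain ⟨_ | i, hi⟩ := h3 (j + 1) (Nat.succ_lt_succ hj)
        · exact absurd hi (h0 j)
        · exact ⟨i, (ho i j).2 hi⟩
      zero_condition := by
        rintro i j hij hij' ⟨⟨i', hi, hi'⟩, j', hj, hj'⟩
        rw [ho] at hij' hi' hj'
        exact h4 (i + 1) (j + 1) (mem_shiftedCells_addCol_succ.2 hij) hij'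
          ⟨⟨i' + 1, by omega, hi'⟩, j' + 1, by omega, hj'⟩
      diagonal_condition := by
        intro i hi hii j hj hij
        rw [ho] at hii hij
        exact h5 (i + 1) (Nat.succ_lt_succ hi) hii (j + 1) (by omega) hij }
  let S : Finset ℕ := {i ∈ range n | (i + 1, 0) ∈ o}
  have hS : ∀ i, i ∈ S ↔ (i + 1, 0) ∈ o := by
    intro i
    simp only [S, mem_filter, mem_range, and_iff_right_iff_imp]
    intro hi
    have := mem_shiftedCells_addCol_zero.1 (h2 hi)
    omega
  refine ⟨T', decide ((0, 0) ∈ o), S, ?_, ?_, ext rfl ?_⟩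
  · intro i hi
    refine mem_unrestricted.2 ⟨by simpa using (mem_filter.1 hi).1, ?_, ?_⟩
    · intro j hj hij i' hi' hij'
      replace hij : (i, j) ∉ o' := hij
      replace hij' : (i', j) ∈ o' := hij'
      rw [ho] at hij hij'
      exact h4 (i + 1) (j + 1) (mem_shiftedCells_addCol_succ.2 hj) hij
        ⟨⟨i' + 1, by omega, hij'⟩, 0, by omega, (hS i).1 hi⟩
    · intro hi'
      change (i, i) ∈ o'
      by_contra h
      rw [ho] at h
      exact h5 (i + 1) (Nat.succ_lt_succ hi') h 0 (by omega) ((hS i).1 hi)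
  · obtain ⟨_ | i, hi⟩ := h3 0 (Nat.succ_pos _)
    · left; simpa using hi
    · exact Or.inr ⟨i, (hS i).2 hi⟩
  · change ∀ i j, (i, j) ∈ T'.addColOnes _ S ↔ (i, j) ∈ o
    rintro (_ | i) (_ | j)
    · rw [zero_zero_mem_addColOnes, decide_eq_true_iff]
    · exact iff_of_false zero_succ_notMem_addColOnes (h0 j)
    · rw [succ_zero_mem_addColOnes, hS]
    · rw [succ_succ_mem_addColOnes, ← ho]

/-- The possible fillings of a new first column. -/
noncomputable def columnChoices (T : TypeBPermutationTableau n) : Finset (Bool × Finset ℕ) :=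
  {p ∈ univ ×ˢ T.unrestricted.powerset | p.1 = true ∨ p.2.Nonempty}

theorem mem_columnChoices {T : TypeBPermutationTableau n} {p : Bool × Finset ℕ} :
    p ∈ T.columnChoices ↔ p.2 ⊆ T.unrestricted ∧ (p.1 = true ∨ p.2.Nonempty) := by
  simp [columnChoices]

/-- The tableaux of length `n + 1` arise from those of length `n` by adding an empty row or a
full column. -/
def extend : TypeBPermutationTableau n ⊕
    (Σ T : TypeBPermutationTableau n, {p // p ∈ T.columnChoices}) →
      TypeBPermutationTableau (n + 1)
  | .inl T => T.addRow
  | .inr ⟨T, p⟩ => T.addCol p.1.1 p.1.2 (mem_columnChoices.1 p.2).1 (mem_columnChoices.1 p.2).2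

theorem addRow_injective : Function.Injective (addRow (n := n)) := by
  intro T T' h
  have hs : T.shape.addRow = T'.shape.addRow := congrArg shape h
  have ho : T.addRow.ones = T'.addRow.ones := congrArg ones h
  refine ext (FerrersDiagram.ext ?_ (congrArg FerrersDiagram.cols hs :) fun i j => ?_) fun i j => ?_
  · exact Nat.succ_injective (congrArg FerrersDiagram.rows hs :)
  · rw [show T.shape.cells = T'.shape.cells from (congrArg FerrersDiagram.cells hs :)]
  · rw [show T.ones = T'.ones from ho]

theorem addRow_ne_addCol (T T' : TypeBPermutationTableau n) (b : Bool) (S : Finset ℕ)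
    (hS : S ⊆ T'.unrestricted) (hb : b = true ∨ S.Nonempty) : T.addRow ≠ T'.addCol b S hS hb := by
  intro h
  have hs : T.shape.addRow = T'.shape.addCol := congrArg shape h
  have hr : T.shape.rows + 1 = T'.shape.rows := congrArg FerrersDiagram.rows hs
  have : (T.shape.rows, 0) ∈ T'.shape.addCol.cells := mem_addCol_zero.2 (by omega)
  rw [← hs] at this
  have := (lt_of_mem_cells (F := T.shape) this).1
  omega

theorem addCol_inj {T T' : TypeBPermutationTableau n} {b b' : Bool} {S S' : Finset ℕ}
    {hS : S ⊆ T.unrestricted} {hb : b = true ∨ S.Nonempty} {hS' : S' ⊆ T'.unrestricted}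
    {hb' : b' = true ∨ S'.Nonempty} (h : T.addCol b S hS hb = T'.addCol b' S' hS' hb') :
    T = T' ∧ b = b' ∧ S = S' := by
  have hs : T.shape.addCol = T'.shape.addCol := congrArg shape h
  have ho : T.addColOnes b S = T'.addColOnes b' S' := congrArg ones h
  refine ⟨ext (FerrersDiagram.ext (congrArg FerrersDiagram.rows hs :)
    (Nat.succ_injective (congrArg FerrersDiagram.cols hs :)) ?_) ?_, ?_, ?_⟩
  · intro i j
    rw [← mem_addCol_succ, hs, mem_addCol_succ]
  · intro i j
    rw [← succ_succ_mem_addColOnes, ho, succ_succ_mem_addColOnes]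
  · rw [Bool.eq_iff_iff, ← zero_zero_mem_addColOnes, ho, zero_zero_mem_addColOnes]
  · ext i
    rw [← succ_zero_mem_addColOnes, ho, succ_zero_mem_addColOnes]

theorem extend_bijective : Function.Bijective (extend (n := n)) := by
  constructor
  · rintro (T | ⟨T, ⟨b, S⟩, hp⟩) (T' | ⟨T', ⟨b', S'⟩, hp'⟩) h
    · rw [addRow_injective h]
    · exact (addRow_ne_addCol T T' b' S' (mem_columnChoices.1 hp').1 (mem_columnChoices.1 hp').2 h).elim
    · exact (addRow_ne_addCol T' T b S (mem_columnChoices.1 hp).1 (mem_columnChoices.1 hp).2 h.symm).elim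
    · have h1 := mem_columnChoices.1 hp
      have h2 := mem_columnChoices.1 hp'
      obtain ⟨rfl, rfl, rfl⟩ := addCol_inj (hS := h1.1) (hb := h1.2) (hS' := h2.1) (hb' := h2.2) h
      rfl
  · intro T
    by_cases h : ∀ r, T.shape.rows = r + 1 → (r, 0) ∈ T.shape.cells
    · obtain ⟨T', b, S, hS, hb, rfl⟩ := exists_addCol_eq h
      exact ⟨.inr ⟨T', ⟨(b, S), mem_columnChoices.2 ⟨hS, hb⟩⟩⟩, rfl⟩
    · push Not at h
      obtain ⟨r, hr, h⟩ := h
      obtain ⟨T', rfl⟩ := exists_addRow_eq hr h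
      exact ⟨.inl T', rfl⟩

end TypeBPermutationTableau

/-! ### The sum over the fillings of a column with diagonal cell `0`. -/

section ColumnSum

variable {A : Type*} [CommRing A]

/-- The sum over the nonempty sets `S` of rows with a `1` in a new column, `x` marking the rows
that remain unrestricted. -/
theorem mul_sum_nonempty_powerset (q x : A) (U : Finset ℕ) :
    (1 + q * x - x) * (∑ S ∈ U.powerset with S.Nonempty,
      q ^ (#S - 1) * x ^ #{i ∈ U | i ∈ S ∨ ∀ s ∈ S, i ≤ s})
      = x * ((1 + q * x) ^ #U - x ^ #U) := by
  induction U using Finset.induction_on_min with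
  | empty => simp [sum_filter]
  | insert a U ha ih =>
    have haU : a ∉ U := fun h => lt_irrefl a (ha a h)
    rw [sum_filter] at ih ⊢
    rw [sum_powerset_insert haU]
    -- The row `a` is above all of `U`. If it is not chosen, it stays unrestricted and contributes a
    -- factor `x`.
    have h1 : ∀ S ∈ U.powerset, (if S.Nonempty then
        q ^ (#S - 1) * x ^ #{i ∈ insert a U | i ∈ S ∨ ∀ s ∈ S, i ≤ s} else 0) =
        x * (if S.Nonempty then q ^ (#S - 1) * x ^ #{i ∈ U | i ∈ S ∨ ∀ s ∈ S, i ≤ s} else 0) := by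
      intro S hS
      rw [mem_powerset] at hS
      rw [filter_insert, if_pos (Or.inr fun s hs => (ha s (hS hs)).le), card_insert_of_notMem]
      · split_ifs
        · ring
        · simp
      · simp [haU]
    -- If `a` is chosen, its `1` is topmost and only the chosen rows stay unrestricted. The power of
    -- 1 gives the summand the shape of the binomial theorem over subsets.
    have h2 : ∀ S ∈ U.powerset, (if (insert a S).Nonempty then q ^ (#(insert a S) - 1) *
        x ^ #{i ∈ insert a U | i ∈ insert a S ∨ ∀ s ∈ insert a S, i ≤ s} else 0) =
        x * ((q * x) ^ #S * 1 ^ (#U - #S)) := by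
      intro S hS
      rw [mem_powerset] at hS
      have h3 : {i ∈ insert a U | i ∈ insert a S ∨ ∀ s ∈ insert a S, i ≤ s} = insert a S := by
        ext i
        simp only [mem_filter, mem_insert, forall_eq_or_imp]
        constructor
        · rintro ⟨rfl | hi, h | h⟩
          · exact Or.inl rfl
          · exact Or.inl rfl
          · exact h
          · exact absurd h.1 (not_le.2 (ha i hi))
        · rintro (rfl | hi)
          · simp
          · exact ⟨Or.inr (hS hi), Or.inl (Or.inr hi)⟩
      rw [if_pos (insert_nonempty a S), h3, card_insert_of_notMem (fun h => haU (hS h))]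
      simp only [Nat.add_sub_cancel, one_pow]
      ring
    rw [sum_congr rfl h1, sum_congr rfl h2, ← mul_sum, ← mul_sum, sum_pow_mul_eq_add_pow,
      card_insert_of_notMem haU]
    linear_combination x * ih

end ColumnSum

/-! ### The recursion for the generating polynomials. -/

namespace TypeBPermutationTableau

open Polynomial

variable {R : Type*} [CommRing R] {n : ℕ}

/-- The weight of a tableau. -/
def weight (y t q : R) (T : TypeBPermutationTableau n) : R :=
  y ^ (2 * T.row + T.diag) * t ^ T.diag * q ^ T.so

/-- The generating polynomial of the type B permutation tableaux of length `n`, in which the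
variable marks the unrestricted rows. -/
noncomputable def unrestrictedPolynomial (y t q : R) (n : ℕ) : R[X] :=
  ∑ T : TypeBPermutationTableau n, C (T.weight y t q) * X ^ #T.unrestricted

theorem eval_one_unrestrictedPolynomial (y t q : R) (n : ℕ) :
    (unrestrictedPolynomial y t q n).eval 1 = tableauPolynomial y t q n := by
  simp [unrestrictedPolynomial, tableauPolynomial, eval_finsetSum, weight]

theorem unrestrictedPolynomial_zero (y t q : R) : unrestrictedPolynomial y t q 0 = 1 := by
  let T₀ : TypeBPermutationTableau 0 :=
    { shape := ⟨0, 0, ∅, by simp, by simp [IsLowerSet]⟩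
      length_eq := rfl
      ones := ∅
      ones_subset := by simp
      exists_one := by simp
      zero_condition := by simp
      diagonal_condition := by simp }
  have h : ∀ T : TypeBPermutationTableau 0, T = T₀ := by
    intro T
    have hn := T.rows_add_cols
    refine ext (FerrersDiagram.ext ?_ ?_ fun i j => iff_of_false ?_ ?_)
      fun i j => iff_of_false ?_ ?_
    · change _ = 0; omega
    · change _ = 0; omega
    · intro h
      have := FerrersDiagram.lt_of_mem_cells h
      omega
    · exact notMem_empty _
    · intro h
      have := lt_cols_of_mem_ones h
      omega
    · exact notMem_empty _
  rw [unrestrictedPolynomial, Fintype.sum_eq_single T₀ fun T hT => absurd (h T) hT]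
  simp [weight, row, diag, so, unrestricted, T₀]

/-- The contribution of the tableaux that arise from `T` by adding a column. -/
theorem mul_sum_columnChoices (y t q : R) (T : TypeBPermutationTableau n) :
    (1 + C q * X - X) * (∑ p : {p // p ∈ T.columnChoices},
      C ((extend (.inr ⟨T, p⟩)).weight y t q) * X ^ #(extend (.inr ⟨T, p⟩)).unrestricted)
      = C (T.weight y t q) * ((1 + C q * X - X) * (C (y * t) * X * (1 + C q * X) ^ #T.unrestricted)
        + X * ((1 + C q * X) ^ #T.unrestricted - X ^ #T.unrestricted)) := by
  -- The factor contributed by one filling. Its truncated `- 1` is a true subtraction on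
  -- `columnChoices`, where the column has a `1`.
  obtain ⟨f, hf⟩ : ∃ f : Bool × Finset ℕ → R[X], f = fun p => C (y * t) ^ p.1.toNat
        * C q ^ (p.1.toNat + #p.2 - 1)
        * X ^ (#{i ∈ T.unrestricted | i ∈ p.2 ∨ (p.1 = false ∧ ∀ s ∈ p.2, i ≤ s)}
          + p.1.toNat) := ⟨_, rfl⟩
  have h : ∀ p : {p // p ∈ T.columnChoices},
      C ((extend (.inr ⟨T, p⟩)).weight y t q) * X ^ #(extend (.inr ⟨T, p⟩)).unrestricted
      = C (T.weight y t q) * f p := by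
    rintro ⟨⟨b, S⟩, hp⟩
    obtain ⟨hS, hb⟩ := mem_columnChoices.1 hp
    have h1 : (T.addCol b S hS hb).so = T.so + (b.toNat + #S - 1) := by
      have h1 := so_addCol T b S hS hb
      have h2 : 1 ≤ b.toNat + #S := by
        rcases hb with hb | hb
        · have : b = true := hb
          simp [this]
        · have := hb.card_pos
          dsimp only at this
          omega
      omega
    change C ((T.addCol b S hS hb).weight y t q) * X ^ #(T.addCol b S hS hb).unrestricted = _
    rw [card_unrestricted_addCol, weight, row_addCol, diag_addCol, h1, weight, hf]
    simp only [map_mul, map_pow]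
    ring
  rw [sum_congr rfl fun p _ => h p, ← mul_sum, sum_coe_sort T.columnChoices f, columnChoices, sum_filter,
    sum_product, Fintype.sum_bool, hf]
  have hS : ∀ S ∈ T.unrestricted.powerset, {i ∈ T.unrestricted | i ∈ S} = S := by
    intro S hS
    rw [filter_mem_eq_inter, inter_eq_right]
    exact mem_powerset.1 hS
  -- Diagonal cell `1`: every row with a `0` in the new column becomes restricted, each chosen row
  -- gives qx, and the new top row gives the extra x.
  have h1 : ∑ S ∈ T.unrestricted.powerset, C (y * t) * C q ^ #S *
      X ^ (#{i ∈ T.unrestricted | i ∈ S} + 1) =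
      C (y * t) * X * (1 + C q * X) ^ #T.unrestricted := by
    rw [add_comm (1 : R[X]), ← sum_pow_mul_eq_add_pow, mul_sum]
    refine sum_congr rfl fun S h => ?_
    rw [hS S h, one_pow]
    ring
  have h2 := mul_sum_nonempty_powerset (C q) X T.unrestricted
  rw [sum_filter] at h2
  simp only [true_or, if_true, Bool.toNat_true, pow_one, reduceCtorEq, false_and, or_false,
    Nat.add_sub_cancel_left, false_or, Bool.toNat_false, pow_zero, one_mul, zero_add, add_zero,
    true_and, Bool.false_eq_true, h1]
  linear_combination C (T.weight y t q) * h2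

/-- By linearity one tableau with u unrestricted rows may be treated at a time: the substitution
turns x^u into (1+qx)^u, and the added empty row gives the term y²x · x^u. -/
theorem isStep_unrestrictedPolynomial (y t q : R) (n : ℕ) :
    IsStep y t q (unrestrictedPolynomial y t q n) (unrestrictedPolynomial y t q (n + 1)) := by
  rw [unrestrictedPolynomial, unrestrictedPolynomial, ← extend_bijective.sum_comp,
    Fintype.sum_sum_type, Fintype.sum_sigma, ← sum_add_distrib]
  refine IsStep.sum fun T _ => ?_
  have h1 := mul_sum_columnChoices y t q T
  have h2 : (extend (.inl T)).weight y t q = y ^ 2 * T.weight y t q := by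
    change T.addRow.weight y t q = _
    rw [weight, row_addRow, diag_addRow, so_addRow, weight]
    ring
  have h3 : #(extend (.inl T)).unrestricted = #T.unrestricted + 1 := card_unrestricted_addRow T
  rw [IsStep, mul_add, h1, h2, h3]
  simp only [mul_comp, C_comp, pow_comp, X_comp, map_mul]
  ring

end TypeBPermutationTableau

theorem theorem6 {R : Type*} [CommRing R] (y t q : R) :
    IsJFractionExpansion
      (PowerSeries.mk (fun n => tableauPolynomial y t q n))
      (fun h => y ^ 2 * qInt q (h + 1) + qInt q h
        + t * y * q ^ h * (qInt q h + qInt q (h + 1)))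
      (fun h => y * qInt q h ^ 2 * (y + t * q ^ (h - 1)) * (1 + y * t * q ^ h)) := by
  have h : ∀ n, tableauPolynomial y t q n = _ := fun n =>
    (TypeBPermutationTableau.eval_one_unrestrictedPolynomial y t q n).symm.trans
      (eval_one_eq_motzkinWeight (TypeBPermutationTableau.unrestrictedPolynomial_zero y t q)
        (TypeBPermutationTableau.isStep_unrestrictedPolynomial y t q) n)
  simp only [h]
  -- Here λ_{k+1} splits as the up weight y(y + tq^k) times the down weight [k+1]_q²(1 + ytq^{k+1}).
  -- The index 0, where `h - 1` is truncated, never occurs.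
  refine isJFractionExpansion_motzkinWeight _ _ _ fun k => ?_
  simp only [Nat.add_sub_cancel]
  ring
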